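/- Let $n\ge 2$, $p\ge 0$, $\mu,\lambda,\tilde\gamma_0\in\mathbb{R}$, $\nu\ge 0$, $\delta\in(0,1)$. A quadruplet is $q=(i,j,l,k)\in[n]^4$ with $i\ne j$, $l\ne k$, $(i,j)\ne(l,k)$; let $\mathcal{T}$ be the set of all quadruplets. For a symmetric $n\times n$ matrix $G$ put $\Delta_qG=(g_{ii}-2g_{ij}+g_{jj})-(g_{ll}-2g_{lk}+g_{kk})$, and let $$\ell_{\tilde\gamma_0,\nu}(\gamma)=\max(\tilde\gamma_0-\gamma,0)+\nu\max(\gamma-\tilde\gamma_0,0).$$ For arbitrary probabilities $p_q\in[0,1]$ $(q\in\mathcal{T})$ draw a sample $\mathcal{Q}$ of $|\mathcal{Q}|\ge1$ independent labelled quadruplets $(q_t,y_t)$: $q_t$ is uniform on $\mathcal{T}$ and, given $q_t=q$, $y_t=1$ with probability $p_q$ and $y_t=-1$ otherwise. The risk of $G$ is $$R(G)=\mathbb{E}\bigl[\ell_{\tilde\gamma_0,\nu}(y\,\Delta_qG)\bigr]=\frac1{|\mathcal{T}|}\sum_{q\in\mathcal{T}}\Bigl(p_q\,\ell_{\tilde\gamma_0,\nu}(\Delta_qG)+(1-p_q)\,\ell_{\tilde\gamma_0,\nu}(-\Delta_qG)\Bigr).$$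 Let $\mathcal{G}_\mu$ be the set of positive semidefinite $n\times n$ matrices with entrywise max-norm at most $\mu$ and nuclear norm at most $\lambda$, and suppose that the true Gram matrix $G^*=X^\top X$, with $X\in\mathbb{R}^{p\times n}$, lies in $\mathcal{G}_\mu$. The DMOE program for the sample is $$\min_{G,\xi,\varepsilon}\ \frac1{|\mathcal{Q}|}\sum_t(\xi_t+\nu\varepsilon_t)\quad\text{s.t.}\quad \tilde\gamma_0-\xi_t\le y_t\Delta_{q_t}G\le\tilde\gamma_0+\varepsilon_t,\ \ \xi_t,\varepsilon_t\ge0\ \ \forall t,\quad G\in\mathcal{G}_\mu,\ \operatorname{rank}(G)\le p .$$ (i) With probability at least $1-\delta$, every solution $\hat G$ of the DMOE program satisfies $$R(\hat G)-R(G^*)\le 4\mu(1+\nu)\sqrt{\frac{32\,n\,p\log n}{|\mathcal{Q}|}}+8\mu(1+\nu)\sqrt{\frac{2\log(2/\delta)}{|\mathcal{Q}|}} .$$ (ii) Consequently $\Theta(pn\log n)$ samples suffice: for all $\mu$, $\nu\ge0$, $\delta\in(0,1)$, $\tau>0$ there are constants $c>0$ and $C$, and sample sizes $N_0(n,p)$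 with $c\,pn\log n\le N_0(n,p)\le C\,pn\log n$ for all $n\ge2$, $p\ge1$, such that for all $n\ge2$, $p\ge1$, $\lambda$, $\tilde\gamma_0$, $(p_q)$ and $G^*$ as above and all $|\mathcal{Q}|\ge N_0(n,p)$, with probability at least $1-\delta$ every solution $\hat G$ of the DMOE program satisfies $R(\hat G)-R(G^*)\le\tau$. -/

import Mathlib

open MeasureTheory ProbabilityTheory
open scoped ENNReal

noncomputable section

namespace OrdinalEmbedding

/-- Admissible quadruplets `(i, j, l, k)`: `i ≠ j`, `l ≠ k` and `(i, j) ≠ (l, k)`. -/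
abbrev Quadruplet (n : ℕ) : Type :=
  {q : Fin n × Fin n × Fin n × Fin n //
    q.1 ≠ q.2.1 ∧ q.2.2.1 ≠ q.2.2.2 ∧ (q.1, q.2.1) ≠ (q.2.2.1, q.2.2.2)}

/-- A labelled quadruplet; the label `+1` is coded by `true`, the label `-1` by `false`. -/
abbrev Observation (n : ℕ) : Type := Quadruplet n × Bool

/-- The numerical value of a label. -/
def labelValue : Bool → ℝ
  | true => 1
  | false => -1

/-- The squared distance `d_ij = g_ii - 2 g_ij + g_jj` read off a Gram matrix. -/
def sqDist {n : ℕ} (G : Matrix (Fin n) (Fin n) ℝ) (i j : Fin n) : ℝ :=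
  G i i - 2 * G i j + G j j

/-- `Δ_q G = d_ij - d_lk` for `q = (i, j, l, k)`. -/
def quadDiff {n : ℕ} (q : Quadruplet n) (G : Matrix (Fin n) (Fin n) ℝ) : ℝ :=
  sqDist G q.1.1 q.1.2.1 - sqDist G q.1.2.2.1 q.1.2.2.2

/-- The margin `γ_q = y_q Δ_q G`. -/
def margin {n : ℕ} (z : Observation n) (G : Matrix (Fin n) (Fin n) ℝ) : ℝ :=
  labelValue z.2 * quadDiff z.1 G

/-- The two-sided hinge loss. -/
def twoSidedHinge (γ₀ ν γ : ℝ) : ℝ := max (γ₀ - γ) 0 + ν * max (γ - γ₀) 0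

/-- The nuclear norm of a square matrix: the sum of its singular values. -/
def nuclearNorm {n : ℕ} (A : Matrix (Fin n) (Fin n) ℝ) : ℝ :=
  ∑ i ∈ Finset.range n, (Matrix.toEuclideanLin A).singularValues i

open scoped Matrix.Norms.Elementwise in
/-- The entrywise maximum norm of a matrix. -/
def maxNorm {n : ℕ} (A : Matrix (Fin n) (Fin n) ℝ) : ℝ := ‖A‖

/-- Positive semidefinite matrices with max-norm at most `μ` and nuclear norm at most `lam`. -/
def gramClass (n : ℕ) (μ lam : ℝ) : Set (Matrix (Fin n) (Fin n) ℝ) :=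
  {G | G.PosSemidef ∧ maxNorm G ≤ μ ∧ nuclearNorm G ≤ lam}

/-- Feasible points `(G, ξ, ε)` of the program for the labelled sample `s`: the Gram matrix
ranges over `gramClass n μ lam` and has rank at most `p`. -/
def IsFeasible {n N : ℕ} (p : ℕ) (μ lam γ₀ : ℝ) (s : Fin N → Observation n)
    (G : Matrix (Fin n) (Fin n) ℝ) (ξ ε : Fin N → ℝ) : Prop :=
  (∀ t, γ₀ - ξ t ≤ margin (s t) G ∧ margin (s t) G ≤ γ₀ + ε t ∧ 0 ≤ ξ t ∧ 0 ≤ ε t) ∧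
    G ∈ gramClass n μ lam ∧ G.rank ≤ p

/-- The objective of the program. -/
def objective {N : ℕ} (ν : ℝ) (ξ ε : Fin N → ℝ) : ℝ :=
  (1 / (N : ℝ)) * ∑ t, (ξ t + ν * ε t)

/-- `G` is (the matrix part of) a minimizer of the program. -/
def IsSolution {n N : ℕ} (p : ℕ) (μ lam γ₀ ν : ℝ) (s : Fin N → Observation n)
    (G : Matrix (Fin n) (Fin n) ℝ) : Prop :=
  ∃ ξ ε : Fin N → ℝ, IsFeasible p μ lam γ₀ s G ξ ε ∧
    ∀ G' ξ' ε', IsFeasible p μ lam γ₀ s G' ξ' ε' → objective ν ξ ε ≤ objective ν ξ' ε'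

/-- The law of one observation: a uniformly distributed quadruplet `q`, whose label is `+1` with
probability `η q` and `-1` with probability `1 - η q`. -/
def observationLaw {n : ℕ} (η : Quadruplet n → unitInterval) : Measure (Observation n) :=
  (Fintype.card (Quadruplet n) : ℝ≥0∞)⁻¹ • ∑ q, bernoulliMeasure (q, true) (q, false) (η q)

/-- The law of `N` independent observations. -/
def sampleLaw {n : ℕ} (η : Quadruplet n → unitInterval) (N : ℕ) :
    Measure (Fin N → Observation n) :=
  Measure.pi fun _ => observationLaw η

/-- The risk `E[ℓ(γ_q)]`, over the uniform quadruplet and its label. -/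
def risk {n : ℕ} (η : Quadruplet n → unitInterval) (γ₀ ν : ℝ)
    (G : Matrix (Fin n) (Fin n) ℝ) : ℝ :=
  ∫ z, twoSidedHinge γ₀ ν (margin z G) ∂(observationLaw η)

/-- The explicit form of the risk. -/
theorem risk_eq {n : ℕ} (η : Quadruplet n → unitInterval) (γ₀ ν : ℝ)
    (G : Matrix (Fin n) (Fin n) ℝ) :
    risk η γ₀ ν G = (1 / (Fintype.card (Quadruplet n) : ℝ)) * ∑ q,
      ((η q : ℝ) * twoSidedHinge γ₀ ν (quadDiff q G) +
        (1 - (η q : ℝ)) * twoSidedHinge γ₀ ν (-quadDiff q G)) := by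
  unfold risk observationLaw
  rw [integral_smul_measure, integral_finsetSum_measure (fun q _ => Integrable.of_finite)]
  simp [integral_bernoulliMeasure, margin, labelValue]

theorem nonempty_quadruplet {n : ℕ} (hn : 2 ≤ n) : Nonempty (Quadruplet n) :=
  ⟨⟨(⟨0, by omega⟩, ⟨1, by omega⟩, ⟨1, by omega⟩, ⟨0, by omega⟩), by simp⟩⟩

theorem isProbabilityMeasure_observationLaw {n : ℕ} (hn : 2 ≤ n)
    (η : Quadruplet n → unitInterval) : IsProbabilityMeasure (observationLaw η) := by
  have := nonempty_quadruplet hn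
  constructor
  simp only [observationLaw, Measure.smul_apply, Measure.finsetSum_apply, measure_univ,
    Finset.sum_const, Finset.card_univ, smul_eq_mul, nsmul_eq_mul, mul_one]
  exact ENNReal.inv_mul_cancel (by simp [Fintype.card_ne_zero]) (by simp)

/-- The excess risk bound for sample size `N`. -/
def riskBound (n p N : ℕ) (μ ν δ : ℝ) : ℝ :=
  4 * μ * (1 + ν) * √(32 * n * p * Real.log n / N) +
    8 * μ * (1 + ν) * √(2 * Real.log (2 / δ) / N)

end OrdinalEmbedding

end

open OrdinalEmbedding

/-!
The bound is the classical one for empirical risk minimization: a concentration inequality for the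
uniform deviation between risk and empirical risk, and a bound on its mean by a Rademacher average.

The slack variables of a solution `G` can be taken to be the two parts of the hinge loss, so `G`
minimizes the empirical loss over the matrices of the class of rank at most `p`, to which the true
Gram matrix belongs (`sum_excessLoss_nonpos_of_isSolution`). Hence the excess risk of `G` is at
most the largest difference between excess risk and empirical excess risk. The sample space is
finite, so one violating solution for each bad sample gives a finite family, and all suprema over
matrices are maxima.

*Concentration.* Squared distances in the class lie in `[0, 4μ]` and the loss is
`(1 + ν)`-Lipschitz, so changing one observation moves the deviation by at most `16μ(1 + ν)`.
McDiarmid's inequality (`hasSubgaussianMGF_of_bounded_differences`) gives the term with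
`log (2/δ)`.

*The mean.* Symmetrization and contraction, carried out together one observation at a time
(`integral_iSup_deviation_le`), bound the mean deviation by `2(1 + ν)` times the Rademacher average
of the functions `Δ_q G`. For every fixed choice of quadruplets this average is at most
`2μ √(32 n p log n N)` (`expect_iSup_quadDiff_le`), by one of two arguments.

* The Cauchy-Schwarz inequality for the Frobenius inner product gives `nμ √(8N)`, which suffices if
  `n ≤ 16 log n`.
* A matrix of the class is the Gram matrix of `n` points of `ℝ^p` in the ball of radius `√μ`
  (`exists_gram_vectors`). Moving the points to the nearest points of a net of `33^p` points changes
  the signed sum, by polarization, by a small multiple of the same supremum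
  (`exists_configDiff_sub`), so the supremum is at most `4/3` of a maximum over `33^(np)`
  configurations, which Massart's lemma bounds. The factor `log n`, which is at least `2` in the
  remaining case `n > 16 log n`, absorbs the constants.

The second part of the theorem follows from the first: for `N ≥ K p n log n` and large `K`, each of
the two terms of the bound is at most `τ / 2`.
-/

open scoped BigOperators NNReal

namespace OrdinalEmbedding

/-! ### Iterated integrals over a finite product -/

section Product

variable {Ω : Type*} [MeasurableSpace Ω] [MeasurableSingletonClass Ω] [Finite Ω]

lemma integral_pi_succ (P : Measure Ω) [IsProbabilityMeasure P] {N : ℕ}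
    (f : (Fin (N + 1) → Ω) → ℝ) :
    ∫ s, f s ∂Measure.pi (fun _ : Fin (N + 1) => P) =
      ∫ z, ∫ s, f (Fin.cons z s) ∂Measure.pi (fun _ : Fin N => P) ∂P := by
  have h := measurePreserving_piFinSuccAbove (fun _ : Fin (N + 1) => P) 0
  rw [← h.symm.integral_comp', integral_prod _ Integrable.of_finite]
  simp [MeasurableEquiv.piFinSuccAbove, Fin.consEquiv]

/-! ### The bounded differences inequality -/

/-- Hoeffding's lemma for a function of oscillation at most `c`. -/
lemma hasSubgaussianMGF_of_oscillation_le {P : Measure Ω} [IsProbabilityMeasure P] {g : Ω → ℝ}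
    {c : ℝ≥0} (h : ∀ z z', |g z - g z'| ≤ c) :
    HasSubgaussianMGF (fun z => g z - ∫ z, g z ∂P) ((c / 2) ^ 2) P := by
  have : Nonempty Ω := P.nonempty_of_neZero
  obtain ⟨z₀, hz₀⟩ := Finite.exists_min g
  have := hasSubgaussianMGF_of_mem_Icc (μ := P) (X := g) (a := g z₀) (b := g z₀ + c)
    Measurable.of_discrete.aemeasurable
    (Filter.Eventually.of_forall fun z =>
      ⟨hz₀ z, by linarith [(abs_le.1 (h z z₀)).2]⟩)
  simpa using this

/-- **McDiarmid's inequality**, at the level of moment generating functions: a function of `N`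
independent variables that moves by at most `c` when one of them is changed is sub-Gaussian with
variance proxy `N * (c / 2) ^ 2`. -/
theorem hasSubgaussianMGF_of_bounded_differences (P : Measure Ω) [IsProbabilityMeasure P]
    {c : ℝ≥0} {N : ℕ} (f : (Fin N → Ω) → ℝ)
    (h : ∀ (s : Fin N → Ω) (t : Fin N) (z : Ω), |f s - f (Function.update s t z)| ≤ c) :
    HasSubgaussianMGF (fun s => f s - ∫ s, f s ∂Measure.pi (fun _ : Fin N => P))
      (N * (c / 2) ^ 2) (Measure.pi fun _ : Fin N => P) := by
  refine ⟨fun _ => Integrable.of_finite, fun r => ?_⟩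
  induction N with
  | zero =>
    have : ∀ s, f s = f Fin.elim0 := fun s => congrArg f (Subsingleton.elim _ _)
    simp [mgf, this]
  | succ N ih =>
    set g : Ω → ℝ := fun z => ∫ s, f (Fin.cons z s) ∂Measure.pi (fun _ : Fin N => P) with hg
    have hosc : ∀ z z', |g z - g z'| ≤ c := by
      intro z z'
      rw [hg]
      dsimp only
      rw [← integral_sub Integrable.of_finite Integrable.of_finite]
      have h2 := norm_integral_le_of_norm_le_const (μ := Measure.pi (fun _ : Fin N => P))
        (f := fun s => f (Fin.cons z s) - f (Fin.cons z' s)) (C := c)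
        (Filter.Eventually.of_forall fun s => by
          have := h (Fin.cons z s) 0 z'
          rwa [Fin.update_cons_zero] at this)
      simpa using h2
    have hhead := (hasSubgaussianMGF_of_oscillation_le (P := P) hosc).mgf_le r
    have htail : ∀ z, mgf (fun s => f (Fin.cons z s) - g z) (Measure.pi fun _ : Fin N => P) r ≤
        Real.exp (((N * (c / 2) ^ 2 : ℝ≥0) : ℝ) * r ^ 2 / 2) := by
      intro z
      refine ih (fun s => f (Fin.cons z s)) fun s t z' => ?_
      have := h (Fin.cons z s) t.succ z'
      rwa [← Fin.cons_update] at this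
    rw [integral_pi_succ P f]
    change mgf (fun s => f s - ∫ z, g z ∂P) _ r ≤ _
    unfold mgf at hhead htail ⊢
    rw [integral_pi_succ]
    calc ∫ z, ∫ s, Real.exp (r * (f (Fin.cons z s) - ∫ z, g z ∂P))
          ∂Measure.pi (fun _ : Fin N => P) ∂P
        = ∫ z, Real.exp (r * (g z - ∫ z, g z ∂P)) *
            ∫ s, Real.exp (r * (f (Fin.cons z s) - g z))
              ∂Measure.pi (fun _ : Fin N => P) ∂P := by
          congr 1; ext z
          rw [← integral_const_mul]
          congr 1; ext s
          rw [← Real.exp_add]; ring_nf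
      _ ≤ ∫ z, Real.exp (r * (g z - ∫ z, g z ∂P)) *
            Real.exp (((N * (c / 2) ^ 2 : ℝ≥0) : ℝ) * r ^ 2 / 2) ∂P :=
          integral_mono Integrable.of_finite Integrable.of_finite fun z =>
            mul_le_mul_of_nonneg_left (htail z) (Real.exp_pos _).le
      _ ≤ Real.exp ((((c / 2) ^ 2 : ℝ≥0) : ℝ) * r ^ 2 / 2) *
            Real.exp (((N * (c / 2) ^ 2 : ℝ≥0) : ℝ) * r ^ 2 / 2) := by
          rw [integral_mul_const]
          exact mul_le_mul_of_nonneg_right hhead (Real.exp_pos _).le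
      _ = _ := by
          rw [← Real.exp_add]; congr 1; push_cast; ring

end Product

/-! ### Averages over independent random signs -/

/-- The value `±1` of a random sign, coded by a Boolean. -/
def signValue (b : Bool) : ℝ := if b then 1 else -1

@[simp] lemma signValue_true : signValue true = 1 := rfl

@[simp] lemma signValue_false : signValue false = -1 := rfl

@[simp] lemma signValue_not (b : Bool) : signValue (!b) = -signValue b := by
  cases b <;> simp

lemma expect_sign_succ {N : ℕ} (F : (Fin (N + 1) → Bool) → ℝ) :
    𝔼 σ, F σ = (𝔼 σ : Fin N → Bool, F (Fin.cons true σ) +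
      𝔼 σ : Fin N → Bool, F (Fin.cons false σ)) / 2 := by
  rw [← Fintype.expect_equiv (Fin.consEquiv fun _ => Bool) (fun x => F (Fin.cons x.1 x.2)) F
    fun _ => rfl]
  simp_rw [Fintype.expect_eq_sum_div_card]
  rw [Fintype.sum_prod_type]
  simp only [Fintype.card_prod, Fintype.card_bool, Fintype.sum_bool]
  push_cast
  field_simp

lemma expect_sign_neg {N : ℕ} (F : (Fin N → Bool) → ℝ) :
    𝔼 σ : Fin N → Bool, F (fun t => !σ t) = 𝔼 σ, F σ :=
  Fintype.expect_equiv (Equiv.arrowCongr (Equiv.refl _) Equiv.boolNot) _ _ fun _ => rfl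

lemma expect_sq_signed_sum {N : ℕ} (x : Fin N → ℝ) (c : ℝ) :
    𝔼 σ : Fin N → Bool, (c + ∑ t, signValue (σ t) * x t) ^ 2 = c ^ 2 + ∑ t, x t ^ 2 := by
  induction N generalizing c with
  | zero => simp
  | succ N ih =>
    rw [expect_sign_succ]
    simp only [Fin.sum_univ_succ, Fin.cons_zero, Fin.cons_succ, ← add_assoc, ih]
    simp; ring

lemma expect_exp_signed_sum_le {N : ℕ} (x : Fin N → ℝ) :
    𝔼 σ : Fin N → Bool, Real.exp (∑ t, signValue (σ t) * x t) ≤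
      Real.exp ((∑ t, x t ^ 2) / 2) := by
  induction N with
  | zero => simp
  | succ N ih =>
    rw [expect_sign_succ]
    simp only [Fin.sum_univ_succ, Fin.cons_zero, Fin.cons_succ, Real.exp_add,
      ← Finset.mul_expect, signValue_true, signValue_false, one_mul, neg_mul]
    have h1 := Real.cosh_le_exp_half_sq (x 0)
    rw [Real.cosh_eq] at h1
    rw [add_div (x 0 ^ 2), Real.exp_add]
    calc _ = (Real.exp (x 0) + Real.exp (-x 0)) / 2 *
          𝔼 σ : Fin N → Bool, Real.exp (∑ t, signValue (σ t) * x t.succ) := by ring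
      _ ≤ _ := mul_le_mul h1 (ih fun t => x t.succ)
          (Finset.expect_nonneg fun _ _ => (Real.exp_pos _).le) (Real.exp_pos _).le

/-- **Massart's lemma**: the expected maximum of the signed sums of finitely many vectors of
squared length at most `V`, with a free parameter `r` left to be optimized. -/
lemma mul_expect_iSup_signed_sum_le {κ : Type*} [Fintype κ] [Nonempty κ] {N : ℕ}
    (v : κ → Fin N → ℝ) {V K r : ℝ} (hV : ∀ k, ∑ t, v k t ^ 2 ≤ V)
    (hK : Real.log (Fintype.card κ) ≤ K) :
    r * 𝔼 σ : Fin N → Bool, ⨆ k, ∑ t, signValue (σ t) * v k t ≤ K + r ^ 2 * V / 2 := by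
  set S : (Fin N → Bool) → ℝ := fun σ => ⨆ k, ∑ t, signValue (σ t) * v k t with hS
  set m : ℝ := r * 𝔼 σ, S σ with hm
  -- the tangent of `exp` at `m` gives Jensen's inequality
  have jensen : Real.exp m ≤ 𝔼 σ, Real.exp (r * S σ) := by
    calc Real.exp m = 𝔼 σ, Real.exp m * (1 + (r * S σ - m)) := by
          rw [← Finset.mul_expect, Finset.expect_add_distrib, Finset.expect_sub_distrib,
            ← Finset.mul_expect, Fintype.expect_const, Fintype.expect_const, ← hm]
          ring
      _ ≤ _ := Finset.expect_le_expect fun σ _ => by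
          have := Real.add_one_le_exp (r * S σ - m)
          calc Real.exp m * (1 + (r * S σ - m)) ≤ Real.exp m * Real.exp (r * S σ - m) := by
                gcongr; linarith
            _ = _ := by rw [← Real.exp_add]; ring_nf
  have union : 𝔼 σ, Real.exp (r * S σ) ≤ Fintype.card κ * Real.exp (r ^ 2 * V / 2) := by
    calc 𝔼 σ, Real.exp (r * S σ)
        ≤ 𝔼 σ : Fin N → Bool, ∑ k, Real.exp (∑ t, signValue (σ t) * (r * v k t)) := by
          refine Finset.expect_le_expect fun σ _ => ?_
          obtain ⟨k, hk⟩ := exists_eq_ciSup_of_finite (f := fun k => ∑ t, signValue (σ t) * v k t)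
          rw [hS]; dsimp only
          rw [← hk, Finset.mul_sum]
          simp_rw [mul_left_comm r]
          exact Finset.single_le_sum
            (f := fun k => Real.exp (∑ t, signValue (σ t) * (r * v k t)))
            (fun _ _ => (Real.exp_pos _).le) (Finset.mem_univ k)
      _ = ∑ k, 𝔼 σ : Fin N → Bool, Real.exp (∑ t, signValue (σ t) * (r * v k t)) :=
          Finset.expect_sum_comm _ _ _
      _ ≤ ∑ _k : κ, Real.exp (r ^ 2 * V / 2) := by
          refine Finset.sum_le_sum fun k _ => (expect_exp_signed_sum_le _).trans ?_
          simp_rw [mul_pow, ← Finset.mul_sum]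
          gcongr
          exact hV k
      _ = _ := by simp
  have hcard : (0 : ℝ) < Fintype.card κ := by exact_mod_cast Fintype.card_pos
  have h3 := Real.log_le_log (Real.exp_pos _) (jensen.trans union)
  rw [Real.log_exp, Real.log_mul hcard.ne' (Real.exp_pos _).ne', Real.log_exp] at h3
  linarith

/-- Massart's lemma with the optimal parameter. -/
lemma sq_expect_iSup_signed_sum_le {κ : Type*} [Fintype κ] [Nonempty κ] {N : ℕ}
    (v : κ → Fin N → ℝ) {V K : ℝ} (hV0 : 0 < V) (hV : ∀ k, ∑ t, v k t ^ 2 ≤ V)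
    (hK : Real.log (Fintype.card κ) ≤ K) :
    (𝔼 σ : Fin N → Bool, ⨆ k, ∑ t, signValue (σ t) * v k t) ^ 2 ≤ 2 * V * K := by
  set m := 𝔼 σ : Fin N → Bool, ⨆ k, ∑ t, signValue (σ t) * v k t with hm
  have h := mul_expect_iSup_signed_sum_le v (r := m / V) hV hK
  rw [← hm] at h
  have h1 : m / V * m - (m / V) ^ 2 * V / 2 = m ^ 2 / (2 * V) := by field_simp; ring
  have h2 : m ^ 2 / (2 * V) ≤ K := by linarith
  rw [div_le_iff₀ (by positivity)] at h2
  linarith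

/-! ### Symmetrization and contraction -/

section Symmetrization

variable {Ω : Type*} [MeasurableSpace Ω] [MeasurableSingletonClass Ω] [Finite Ω]
  {ι : Type*} [Finite ι] [Nonempty ι]

/-- Contraction in one coordinate: a function that varies less than `a` may be replaced by `a`
under a random sign. -/
lemma iSup_add_iSup_sub_le (c h a : ι → ℝ) (hL : ∀ i j, |h i - h j| ≤ |a i - a j|) :
    (⨆ i, (c i + h i)) + (⨆ i, (c i - h i)) ≤ (⨆ i, (c i + a i)) + ⨆ i, (c i - a i) := by
  obtain ⟨i, hi⟩ := exists_eq_ciSup_of_finite (f := fun i => c i + h i)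
  obtain ⟨j, hj⟩ := exists_eq_ciSup_of_finite (f := fun i => c i - h i)
  rw [← hi, ← hj]
  have hp := fun k => le_ciSup (Set.finite_range fun i => c i + a i).bddAbove k
  have hm := fun k => le_ciSup (Set.finite_range fun i => c i - a i).bddAbove k
  have h1 := (le_abs_self _).trans (hL i j)
  rcases abs_cases (a i - a j) with ⟨h2, -⟩ | ⟨h2, -⟩
  · linarith [hp i, hm j]
  · linarith [hp j, hm i]

/-- Symmetrization and contraction for one observation. -/
lemma integral_iSup_centered_le (P : Measure Ω) [IsProbabilityMeasure P] (h a : ι → Ω → ℝ)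
    (hL : ∀ i j z, |h i z - h j z| ≤ |a i z - a j z|) (c : ι → ℝ) :
    ∫ z, ⨆ i, (c i + (∫ z', h i z' ∂P - h i z)) ∂P ≤
      ∫ z, ((⨆ i, (c i + 2 * a i z)) + ⨆ i, (c i - 2 * a i z)) / 2 ∂P := by
  have bdd : ∀ f : ι → ℝ, BddAbove (Set.range f) := fun f => (Set.finite_range f).bddAbove
  have mean : ∀ i, c i + 2 * ∫ z', h i z' ∂P ≤ ∫ z, ⨆ i, (c i + 2 * h i z) ∂P := fun i => by
    calc c i + 2 * ∫ z', h i z' ∂P = ∫ z, (c i + 2 * h i z) ∂P := by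
          rw [integral_add Integrable.of_finite Integrable.of_finite, integral_const_mul]; simp
      _ ≤ _ := integral_mono Integrable.of_finite Integrable.of_finite fun z =>
          le_ciSup (bdd fun i => c i + 2 * h i z) i
  calc ∫ z, ⨆ i, (c i + (∫ z', h i z' ∂P - h i z)) ∂P
      ≤ ∫ z, ((∫ z, ⨆ i, (c i + 2 * h i z) ∂P) + ⨆ i, (c i - 2 * h i z)) / 2 ∂P := by
        refine integral_mono Integrable.of_finite Integrable.of_finite fun z => ciSup_le fun i => ?_
        have := le_ciSup (bdd fun i => c i - 2 * h i z) i
        have := mean i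
        linarith
    _ = ∫ z, ((⨆ i, (c i + 2 * h i z)) + ⨆ i, (c i - 2 * h i z)) / 2 ∂P := by
        rw [integral_div, integral_div, integral_add Integrable.of_finite Integrable.of_finite,
          integral_add Integrable.of_finite Integrable.of_finite]
        simp
    _ ≤ _ := by
        refine integral_mono Integrable.of_finite Integrable.of_finite fun z => ?_
        have := iSup_add_iSup_sub_le c (fun i => 2 * h i z) (fun i => 2 * a i z) fun i j => by
          rw [← mul_sub, ← mul_sub, abs_mul, abs_mul]
          exact mul_le_mul_of_nonneg_left (hL i j z) (abs_nonneg _)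
        dsimp only
        linarith

/-- **Symmetrization and contraction.** The expected maximal deviation between the mean and the
empirical mean of the functions `h i` is at most twice the Rademacher average of any functions
`a i` that vary more with `i` than the `h i` do. The offsets `c i` allow for an induction that
handles the observations one at a time, so that no independent copy of the sample is needed. -/
theorem integral_iSup_deviation_le (P : Measure Ω) [IsProbabilityMeasure P] (h a : ι → Ω → ℝ)
    (hL : ∀ i j z, |h i z - h j z| ≤ |a i z - a j z|) (N : ℕ) (c : ι → ℝ) :
    ∫ s, ⨆ i, (c i + ∑ t, (∫ z, h i z ∂P - h i (s t))) ∂Measure.pi (fun _ : Fin N => P) ≤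
      ∫ s, 𝔼 σ : Fin N → Bool, ⨆ i, (c i + ∑ t, signValue (σ t) * (2 * a i (s t)))
        ∂Measure.pi (fun _ : Fin N => P) := by
  induction N generalizing c with
  | zero => simp
  | succ N ih =>
    rw [integral_pi_succ, integral_pi_succ,
      integral_integral_swap (f := fun z s => ⨆ i, (c i + ∑ t, (∫ z, h i z ∂P -
        h i ((Fin.cons z s : Fin (N + 1) → Ω) t)))) Integrable.of_finite]
    simp only [Fin.sum_univ_succ, Fin.cons_zero, Fin.cons_succ, expect_sign_succ,
      signValue_true, signValue_false, one_mul, neg_mul]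
    calc ∫ s, ∫ z, ⨆ i, (c i + (∫ z, h i z ∂P - h i z +
            ∑ t, (∫ z, h i z ∂P - h i (s t)))) ∂P ∂Measure.pi (fun _ : Fin N => P)
        ≤ ∫ s, ∫ z,
            ((⨆ i, (c i + 2 * a i z + ∑ t, (∫ z, h i z ∂P - h i (s t)))) +
              ⨆ i, (c i - 2 * a i z + ∑ t, (∫ z, h i z ∂P - h i (s t)))) / 2
              ∂P ∂Measure.pi (fun _ : Fin N => P) := by
          refine integral_mono Integrable.of_finite Integrable.of_finite fun s => ?_
          have := integral_iSup_centered_le P h a hL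
            fun i => c i + ∑ t, (∫ z, h i z ∂P - h i (s t))
          simp only [add_right_comm, add_sub_right_comm] at this
          simpa only [add_assoc, add_left_comm, add_comm] using this
      _ = ∫ z, ((∫ s, ⨆ i, (c i + 2 * a i z + ∑ t, (∫ z, h i z ∂P - h i (s t)))
              ∂Measure.pi (fun _ : Fin N => P)) +
            ∫ s, ⨆ i, (c i - 2 * a i z + ∑ t, (∫ z, h i z ∂P - h i (s t)))
              ∂Measure.pi (fun _ : Fin N => P)) / 2 ∂P := by
          rw [integral_integral_swap Integrable.of_finite]
          congr 1; ext z
          rw [integral_div, integral_add Integrable.of_finite Integrable.of_finite]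
      _ ≤ ∫ z, ((∫ s, 𝔼 σ : Fin N → Bool, ⨆ i, (c i + 2 * a i z +
              ∑ t, signValue (σ t) * (2 * a i (s t))) ∂Measure.pi (fun _ : Fin N => P)) +
            ∫ s, 𝔼 σ : Fin N → Bool, ⨆ i, (c i - 2 * a i z +
              ∑ t, signValue (σ t) * (2 * a i (s t)))
              ∂Measure.pi (fun _ : Fin N => P)) / 2 ∂P := by
          refine integral_mono Integrable.of_finite Integrable.of_finite fun z => ?_
          have h1 := ih fun i => c i + 2 * a i z
          have h2 := ih fun i => c i - 2 * a i z
          dsimp only at h1 h2 ⊢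
          linarith
      _ = _ := by
          congr 1; ext z
          rw [integral_div, integral_add Integrable.of_finite Integrable.of_finite]
          simp only [sub_eq_add_neg, add_assoc]

end Symmetrization

/-! ### Finite nets of the unit ball -/

section Net

variable {E : Type*} [NormedAddCommGroup E] [NormedSpace ℝ E] [FiniteDimensional ℝ E]

open Metric Module in
/-- Volume bound for packings of the unit ball: the balls of radius `ε / 2` about the points of an
`ε`-separated set are disjoint and lie in the ball of radius `1 + ε / 2`. -/
lemma card_le_of_separated_unit_ball {ε : ℝ} (hε : 0 < ε) (s : Finset E) (hs : ∀ c ∈ s, ‖c‖ ≤ 1)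
    (h : ∀ c ∈ s, ∀ d ∈ s, c ≠ d → ε ≤ ‖c - d‖) :
    (s.card : ℝ) ≤ (1 + 2 / ε) ^ finrank ℝ E := by
  borelize E
  let vol : Measure E := Measure.addHaar
  have hr : 0 < ε / 2 := by positivity
  have hR : 0 < 1 + ε / 2 := by positivity
  have disj : (s : Set E).PairwiseDisjoint fun c => ball c (ε / 2) := by
    intro c hc d hd hcd
    apply ball_disjoint_ball
    rw [dist_eq_norm]
    linarith [h c hc d hd hcd]
  have sub : (⋃ c ∈ s, ball c (ε / 2)) ⊆ ball (0 : E) (1 + ε / 2) := by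
    refine Set.iUnion₂_subset fun x hx => ball_subset_ball' ?_
    rw [dist_zero_right]
    linarith [hs x hx]
  have hvol : (s.card : ℝ≥0∞) * ENNReal.ofReal ((ε / 2) ^ finrank ℝ E) * vol (ball 0 1) ≤
      ENNReal.ofReal ((1 + ε / 2) ^ finrank ℝ E) * vol (ball 0 1) := by
    have := measure_mono (μ := vol) sub
    rw [measure_biUnion_finset disj fun c _ => measurableSet_ball] at this
    simpa only [vol.addHaar_ball_of_pos _ hr, vol.addHaar_ball_of_pos _ hR, Finset.sum_const,
      nsmul_eq_mul, mul_assoc] using this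
  have hreal := ENNReal.toReal_le_of_le_ofReal (pow_nonneg hR.le _)
    ((ENNReal.mul_le_mul_iff_left (measure_ball_pos _ _ zero_lt_one).ne'
      measure_ball_lt_top.ne).1 hvol)
  rw [ENNReal.toReal_mul, ENNReal.toReal_natCast, ENNReal.toReal_ofReal (by positivity),
    ← le_div_iff₀ (by positivity), ← div_pow] at hreal
  rwa [show 1 + 2 / ε = (1 + ε / 2) / (ε / 2) by field_simp; ring]

open Module in
/-- The unit ball has an `ε`-net of at most `(1 + 2 / ε) ^ dim` points: take a maximal
`ε`-separated subset. -/
lemma exists_net_unit_ball {ε : ℝ} (hε : 0 < ε) :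
    ∃ T : Finset E, (∀ x ∈ T, ‖x‖ ≤ 1) ∧ (∀ x, ‖x‖ ≤ 1 → ∃ y ∈ T, ‖x - y‖ ≤ ε) ∧
      (T.card : ℝ) ≤ (1 + 2 / ε) ^ finrank ℝ E := by
  classical
  let K : Set ℕ := {k | ∃ T : Finset E, T.card = k ∧ (∀ c ∈ T, ‖c‖ ≤ 1) ∧
    ∀ c ∈ T, ∀ d ∈ T, c ≠ d → ε ≤ ‖c - d‖}
  have hne : K.Nonempty := ⟨0, ∅, by simp⟩
  have hbdd : BddAbove K := by
    refine ⟨⌊(1 + 2 / ε) ^ finrank ℝ E⌋₊, ?_⟩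
    rintro k ⟨T, rfl, h1, h2⟩
    exact Nat.le_floor (card_le_of_separated_unit_ball hε T h1 h2)
  obtain ⟨T, hT, h1, h2⟩ := Nat.sSup_mem hne hbdd
  refine ⟨T, h1, fun x hx => ?_, card_le_of_separated_unit_ball hε T h1 h2⟩
  by_contra! hfar
  have hxT : x ∉ T := fun hmem => by
    have := hfar x hmem
    simp at this
    linarith
  have hmem : T.card + 1 ∈ K := by
    refine ⟨insert x T, Finset.card_insert_of_notMem hxT, ?_, ?_⟩
    · simpa [Finset.forall_mem_insert] using ⟨hx, h1⟩
    · intro c hc d hd hcd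
      rcases Finset.mem_insert.1 hc with rfl | hcT
      · rcases Finset.mem_insert.1 hd with rfl | hdT
        · exact absurd rfl hcd
        · exact (hfar d hdT).le
      · rcases Finset.mem_insert.1 hd with rfl | hdT
        · rw [norm_sub_rev]; exact (hfar c hcT).le
        · exact h2 c hcT d hdT hcd
  have := le_csSup hbdd hmem
  omega

end Net

/-! ### Rademacher averages of configurations of points -/

section Configuration

variable {E : Type*} [NormedAddCommGroup E] [InnerProductSpace ℝ E] {n N : ℕ}

/-- The difference `‖x_i - x_j‖² - ‖x_l - x_k‖²` of squared distances in a configuration of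
points, for the quadruplet `(i, j, l, k)`. -/
def configDiff (q : Quadruplet n) (x : Fin n → E) : ℝ :=
  ‖x q.1.1 - x q.1.2.1‖ ^ 2 - ‖x q.1.2.2.1 - x q.1.2.2.2‖ ^ 2

lemma configDiff_smul (q : Quadruplet n) (r : ℝ) (x : Fin n → E) :
    configDiff q (fun i => r • x i) = r ^ 2 * configDiff q x := by
  simp only [configDiff, ← smul_sub, norm_smul, mul_pow, Real.norm_eq_abs, sq_abs]
  ring

lemma abs_configDiff_le (q : Quadruplet n) {x : Fin n → E} {r : ℝ} (hx : ∀ i, ‖x i‖ ^ 2 ≤ r) :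
    |configDiff q x| ≤ 4 * r := by
  have h : ∀ i j, ‖x i - x j‖ ^ 2 ≤ 4 * r := fun i j => by
    have := parallelogram_law_with_norm ℝ (x i) (x j)
    nlinarith [hx i, hx j, norm_nonneg (x i + x j)]
  rw [configDiff, abs_le]
  constructor <;> linarith [h q.1.1 q.1.2.1, h q.1.2.2.1 q.1.2.2.2,
    sq_nonneg ‖x q.1.1 - x q.1.2.1‖, sq_nonneg ‖x q.1.2.2.1 - x q.1.2.2.2‖]

lemma norm_sq_sub_norm_sq (x y : E) {ε : ℝ} (hε : ε ≠ 0) :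
    ‖x‖ ^ 2 - ‖y‖ ^ 2 = 2 * ε * (‖(1 / 2 : ℝ) • (ε⁻¹ • (x - y) + (1 / 2 : ℝ) • (x + y))‖ ^ 2 -
      ‖(1 / 2 : ℝ) • (ε⁻¹ • (x - y) - (1 / 2 : ℝ) • (x + y))‖ ^ 2) := by
  simp only [norm_smul, mul_pow, norm_add_sq_real, norm_sub_sq_real, inner_smul_left,
    inner_smul_right, inner_add_right, inner_sub_left, real_inner_self_eq_norm_sq,
    real_inner_comm x y]
  simp
  field_simp
  ring

/-- Polarization: if two configurations in the unit ball are pointwise within `ε`, then their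
`configDiff` differ by `2 * ε` times a difference of two values of `configDiff` at configurations
in the unit ball, the same two for all quadruplets. -/
lemma exists_configDiff_sub {ε : ℝ} (hε : 0 < ε) {x y : Fin n → E} (hx : ∀ i, ‖x i‖ ≤ 1)
    (hy : ∀ i, ‖y i‖ ≤ 1) (hxy : ∀ i, ‖x i - y i‖ ≤ ε) :
    ∃ a b : Fin n → E, (∀ i, ‖a i‖ ≤ 1) ∧ (∀ i, ‖b i‖ ≤ 1) ∧
      ∀ q, configDiff q x - configDiff q y = 2 * ε * (configDiff q a - configDiff q b) := by
  have hu : ∀ i, ‖ε⁻¹ • (x i - y i)‖ ≤ 1 := fun i => by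
    rw [norm_smul, norm_inv, Real.norm_of_nonneg hε.le, inv_mul_le_iff₀ hε, mul_one]
    exact hxy i
  have hv : ∀ i, ‖(1 / 2 : ℝ) • (x i + y i)‖ ≤ 1 := fun i => by
    rw [norm_smul, Real.norm_of_nonneg (by norm_num)]
    linarith [norm_add_le (x i) (y i), hx i, hy i]
  refine ⟨fun i => (1 / 2 : ℝ) • (ε⁻¹ • (x i - y i) + (1 / 2 : ℝ) • (x i + y i)),
    fun i => (1 / 2 : ℝ) • (ε⁻¹ • (x i - y i) - (1 / 2 : ℝ) • (x i + y i)),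
    fun i => ?_, fun i => ?_, fun q => ?_⟩
  · rw [norm_smul, Real.norm_of_nonneg (by norm_num)]
    linarith [norm_add_le (ε⁻¹ • (x i - y i)) ((1 / 2 : ℝ) • (x i + y i)), hu i, hv i]
  · rw [norm_smul, Real.norm_of_nonneg (by norm_num)]
    linarith [norm_sub_le (ε⁻¹ • (x i - y i)) ((1 / 2 : ℝ) • (x i + y i)), hu i, hv i]
  · have key : ∀ i j, ‖x i - x j‖ ^ 2 - ‖y i - y j‖ ^ 2 = 2 * ε *
        (‖(1 / 2 : ℝ) • (ε⁻¹ • (x i - y i) + (1 / 2 : ℝ) • (x i + y i)) -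
          (1 / 2 : ℝ) • (ε⁻¹ • (x j - y j) + (1 / 2 : ℝ) • (x j + y j))‖ ^ 2 -
        ‖(1 / 2 : ℝ) • (ε⁻¹ • (x i - y i) - (1 / 2 : ℝ) • (x i + y i)) -
          (1 / 2 : ℝ) • (ε⁻¹ • (x j - y j) - (1 / 2 : ℝ) • (x j + y j))‖ ^ 2) := fun i j => by
      rw [norm_sq_sub_norm_sq (x i - x j) (y i - y j) hε.ne']
      congr 4 <;> module
    have h1 := key q.1.1 q.1.2.1
    have h2 := key q.1.2.2.1 q.1.2.2.2
    simp only [configDiff]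
    linarith

/-- The largest signed sum of `configDiff` over the configurations in the unit ball. -/
noncomputable def configSup (E : Type*) [NormedAddCommGroup E] [InnerProductSpace ℝ E]
    (q : Fin N → Quadruplet n) (σ : Fin N → Bool) : ℝ :=
  ⨆ x : {x : Fin n → E // ∀ i, ‖x i‖ ≤ 1}, ∑ t, signValue (σ t) * configDiff (q t) x.1

lemma abs_signValue (b : Bool) : |signValue b| = 1 := by cases b <;> simp

lemma le_configSup (q : Fin N → Quadruplet n) (σ : Fin N → Bool) {x : Fin n → E}
    (hx : ∀ i, ‖x i‖ ≤ 1) :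
    ∑ t, signValue (σ t) * configDiff (q t) x ≤ configSup E q σ := by
  refine le_ciSup (f := fun x : {x : Fin n → E // ∀ i, ‖x i‖ ≤ 1} =>
    ∑ t, signValue (σ t) * configDiff (q t) x.1) ⟨N * 4, ?_⟩ ⟨x, hx⟩
  rintro _ ⟨y, rfl⟩
  calc ∑ t, signValue (σ t) * configDiff (q t) y.1 ≤ ∑ _t : Fin N, (4 : ℝ) := by
        refine Finset.sum_le_sum fun t _ => (le_abs_self _).trans ?_
        rw [abs_mul, abs_signValue, one_mul]
        refine (abs_configDiff_le (q t) (r := 1) fun i => ?_).trans (by norm_num)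
        exact pow_le_one₀ (norm_nonneg _) (y.2 i)
    _ = N * 4 := by simp

/-- A net of `33 ^ dim` points of mesh `1 / 16` loses only a factor `4 / 3`: the remainder is again
a signed sum over configurations in the unit ball, and `1 - 4 * (1 / 16) = 3 / 4`. -/
lemma sq_expect_configSup_le [FiniteDimensional ℝ E] (q : Fin N → Quadruplet n) (hN : 0 < N) :
    (3 / 4 * 𝔼 σ, configSup E q σ) ^ 2 ≤
      32 * N * (n * Module.finrank ℝ E * Real.log 33) := by
  obtain ⟨T, hT1, hT2, hT3⟩ := exists_net_unit_ball (E := E) (ε := 1 / 16) (by norm_num)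
  have hTne : Nonempty T := by
    obtain ⟨y, hy, -⟩ := hT2 0 (by simp)
    exact ⟨⟨y, hy⟩⟩
  set m : (Fin N → Bool) → ℝ := fun σ =>
    ⨆ k : Fin n → T, ∑ t, signValue (σ t) * configDiff (q t) (fun i => (k i : E)) with hm
  have step : ∀ σ, configSup E q σ ≤
      m σ + 1 / 8 * (configSup E q σ + configSup E q fun t => !σ t) := by
    intro σ
    have : Nonempty {x : Fin n → E // ∀ i, ‖x i‖ ≤ 1} := ⟨⟨0, by simp⟩⟩
    refine ciSup_le fun ⟨x, hx⟩ => ?_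
    choose k hkT hk using fun i => hT2 (x i) (hx i)
    obtain ⟨a, b, ha, hb, hab⟩ := exists_configDiff_sub (by norm_num) hx
      (fun i => hT1 _ (hkT i)) hk
    have h1 := le_configSup q σ ha
    have h2 := le_configSup q (fun t => !σ t) hb
    have h3 : ∑ t, signValue (σ t) * configDiff (q t) k ≤ m σ :=
      le_ciSup (f := fun k : Fin n → T =>
        ∑ t, signValue (σ t) * configDiff (q t) (fun i => (k i : E)))
        (Set.finite_range _).bddAbove fun i => ⟨k i, hkT i⟩
    have h4 : ∑ t, signValue (σ t) * configDiff (q t) x =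
        ∑ t, signValue (σ t) * configDiff (q t) k +
          1 / 8 * (∑ t, signValue (σ t) * configDiff (q t) a +
            ∑ t, signValue (!σ t) * configDiff (q t) b) := by
      rw [← Finset.sum_add_distrib, Finset.mul_sum, ← Finset.sum_add_distrib]
      refine Finset.sum_congr rfl fun t _ => ?_
      rw [signValue_not, show configDiff (q t) x = configDiff (q t) k +
        2 * (1 / 16) * (configDiff (q t) a - configDiff (q t) b) by linarith [hab (q t)]]
      ring
    dsimp only
    rw [h4]
    linarith
  have hmean : 3 / 4 * 𝔼 σ, configSup E q σ ≤ 𝔼 σ, m σ := by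
    have := Finset.expect_le_expect (s := Finset.univ) fun σ _ => step σ
    rw [Finset.expect_add_distrib, ← Finset.mul_expect, Finset.expect_add_distrib,
      expect_sign_neg (configSup E q)] at this
    linarith
  have hnonneg : 0 ≤ 𝔼 σ, configSup E q σ := Finset.expect_nonneg fun σ _ => by
    simpa [configDiff] using le_configSup q σ (x := fun _ => (0 : E)) (by simp)
  have hmassart : (𝔼 σ, m σ) ^ 2 ≤ 2 * (16 * N) * (n * Module.finrank ℝ E * Real.log 33) := by
    refine sq_expect_iSup_signed_sum_le _ (by positivity) (fun k => ?_) ?_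
    · calc ∑ t, configDiff (q t) (fun i => (k i : E)) ^ 2 ≤ ∑ _t : Fin N, (16 : ℝ) := by
            refine Finset.sum_le_sum fun t _ => ?_
            have := abs_configDiff_le (q t) (x := fun i => (k i : E)) (r := 1) fun i =>
              pow_le_one₀ (norm_nonneg _) (hT1 _ (k i).2)
            rw [← sq_abs]
            nlinarith [abs_nonneg (configDiff (q t) fun i => (k i : E))]
        _ = 16 * N := by simp [mul_comm]
    · have hT0 : (0 : ℝ) < T.card := by
        exact_mod_cast Finset.card_pos.2 ⟨_, (Classical.arbitrary T).2⟩
      rw [Fintype.card_fun, Fintype.card_coe, Fintype.card_fin, Nat.cast_pow, Real.log_pow,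
        mul_assoc]
      gcongr
      rw [← Real.log_pow]
      exact Real.log_le_log hT0 (hT3.trans_eq (by norm_num))
  calc _ ≤ (𝔼 σ, m σ) ^ 2 := by gcongr
    _ ≤ _ := hmassart.trans_eq (by ring)

end Configuration

/-! ### Positive semidefinite matrices of bounded rank -/

section Gram

variable {n p : ℕ} {G : Matrix (Fin n) (Fin n) ℝ}

/-- A Euclidean space of dimension at most `p` embeds isometrically into `ℝ^p`. -/
lemma exists_linearIsometry_of_finrank_le {V : Type*} [NormedAddCommGroup V]
    [InnerProductSpace ℝ V] [FiniteDimensional ℝ V] (h : Module.finrank ℝ V ≤ p) :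
    Nonempty (V →ₗᵢ[ℝ] EuclideanSpace ℝ (Fin p)) := by
  let b := stdOrthonormalBasis ℝ V
  let w : Fin (Module.finrank ℝ V) → EuclideanSpace ℝ (Fin p) :=
    fun i => EuclideanSpace.single (Fin.castLE h i) 1
  have hw : Orthonormal ℝ w :=
    EuclideanSpace.orthonormal_single.comp _ (Fin.castLE_injective h)
  refine ⟨(b.toBasis.constr ℝ w).isometryOfOrthonormal (v := b.toBasis) ?_ ?_⟩
  · simp [b.orthonormal]
  · convert hw
    ext1 i
    simp

open scoped MatrixOrder in
/-- A positive semidefinite matrix of rank at most `p` is the Gram matrix of vectors of `ℝ^p`. -/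
lemma exists_gram_vectors (hG : G.PosSemidef) (hr : G.rank ≤ p) :
    ∃ x : Fin n → EuclideanSpace ℝ (Fin p), ∀ i j, G i j = inner ℝ (x i) (x j) := by
  obtain ⟨B, hB⟩ := CStarAlgebra.nonneg_iff_eq_star_mul_self.mp hG.nonneg
  rw [Matrix.star_eq_conjTranspose] at hB
  let y : Fin n → EuclideanSpace ℝ (Fin n) := fun i => WithLp.toLp 2 (B.col i)
  let V := Submodule.span ℝ (Set.range y)
  have hV : Module.finrank ℝ V ≤ p := by
    rw [hB, Matrix.rank_conjTranspose_mul_self, Matrix.rank_eq_finrank_span_cols] at hr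
    have hmap : V = (Submodule.span ℝ (Set.range B.col)).map
        ((WithLp.linearEquiv 2 ℝ (Fin n → ℝ)).symm : (Fin n → ℝ) →ₗ[ℝ] _) := by
      rw [Submodule.map_span, ← Set.range_comp]
      rfl
    rwa [hmap, LinearEquiv.finrank_map_eq]
  obtain ⟨φ⟩ := exists_linearIsometry_of_finrank_le hV
  refine ⟨fun i => φ ⟨y i, Submodule.subset_span ⟨i, rfl⟩⟩, fun i j => ?_⟩
  rw [φ.inner_map_map, Submodule.coe_inner, hB, Matrix.mul_apply, PiLp.inner_apply]
  exact Finset.sum_congr rfl fun k _ => by simp [y, mul_comm]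

lemma abs_entry_le_maxNorm (G : Matrix (Fin n) (Fin n) ℝ) (i j : Fin n) :
    |G i j| ≤ maxNorm G := by
  let _ : SeminormedAddCommGroup (Matrix (Fin n) (Fin n) ℝ) := Matrix.seminormedAddCommGroup
  exact Matrix.norm_entry_le_entrywise_sup_norm G

lemma quadDiff_eq_configDiff {x : Fin n → EuclideanSpace ℝ (Fin p)}
    (hx : ∀ i j, G i j = inner ℝ (x i) (x j)) (q : Quadruplet n) :
    quadDiff q G = configDiff q x := by
  simp only [quadDiff, sqDist, configDiff, norm_sub_sq_real, hx, real_inner_self_eq_norm_sq]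

lemma norm_sq_gram_vector_le {x : Fin n → EuclideanSpace ℝ (Fin p)} {μ : ℝ}
    (hx : ∀ i j, G i j = inner ℝ (x i) (x j)) (hμ : maxNorm G ≤ μ) (i : Fin n) :
    ‖x i‖ ^ 2 ≤ μ := by
  rw [← real_inner_self_eq_norm_sq, ← hx]
  exact (le_abs_self _).trans ((abs_entry_le_maxNorm G i i).trans hμ)

lemma abs_quadDiff_le {μ : ℝ} (hG : G.PosSemidef) (hμ : maxNorm G ≤ μ) (q : Quadruplet n) :
    |quadDiff q G| ≤ 4 * μ := by
  obtain ⟨x, hx⟩ := exists_gram_vectors hG le_rfl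
  rw [quadDiff_eq_configDiff hx]
  exact abs_configDiff_le q (norm_sq_gram_vector_le hx hμ)

end Gram

/-! ### The Rademacher average of the matrix class -/

section Rademacher

variable {n p N : ℕ} {ι : Type*} [Nonempty ι]

/-- The entries of the matrix `u uᵀ - w wᵀ` that represents `quadDiff q`, where
`u = e_i - e_j` and `w = e_l - e_k` for `q = (i, j, l, k)`. -/
def quadCoeff (q : Quadruplet n) (a b : Fin n) : ℝ :=
  (Pi.single q.1.1 1 - Pi.single q.1.2.1 1 : Fin n → ℝ) a *
      (Pi.single q.1.1 1 - Pi.single q.1.2.1 1 : Fin n → ℝ) b -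
    (Pi.single q.1.2.2.1 1 - Pi.single q.1.2.2.2 1 : Fin n → ℝ) a *
      (Pi.single q.1.2.2.1 1 - Pi.single q.1.2.2.2 1 : Fin n → ℝ) b

lemma sum_quadCoeff_mul {G : Matrix (Fin n) (Fin n) ℝ} (hG : G.PosSemidef) (q : Quadruplet n) :
    ∑ a, ∑ b, quadCoeff q a b * G a b = quadDiff q G := by
  have key : ∀ i j, ∑ a, ∑ b, (Pi.single i 1 - Pi.single j 1 : Fin n → ℝ) a *
      (Pi.single i 1 - Pi.single j 1 : Fin n → ℝ) b * G a b = sqDist G i j := fun i j => by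
    have hsymm : G j i = G i j := by simpa using hG.1.apply i j
    have eval : ∀ f : Fin n → ℝ,
        ∑ b, (Pi.single i 1 - Pi.single j 1 : Fin n → ℝ) b * f b = f i - f j := fun f => by
      simp [sub_mul, Pi.single_apply]
    simp only [mul_assoc, ← Finset.mul_sum, eval, sqDist, hsymm]
    ring
  simp only [quadCoeff, sub_mul, Finset.sum_sub_distrib, quadDiff]
  rw [← key, ← key]

/-- The squared Frobenius norm is `‖u‖⁴ + ‖w‖⁴ - 2⟨u, w⟩²` with `‖u‖² = ‖w‖² = 2`. -/
lemma sum_sq_quadCoeff_le (q : Quadruplet n) : ∑ a, ∑ b, quadCoeff q a b ^ 2 ≤ 8 := by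
  have hnorm : ∀ i j : Fin n, i ≠ j →
      ∑ a, (Pi.single i 1 - Pi.single j 1 : Fin n → ℝ) a ^ 2 = 2 := fun i j hij => by
    simp [Pi.single_apply, sub_sq, Finset.sum_add_distrib, Finset.sum_sub_distrib, hij.symm]
    norm_num
  set u : Fin n → ℝ := Pi.single q.1.1 1 - Pi.single q.1.2.1 1 with hu
  set w : Fin n → ℝ := Pi.single q.1.2.2.1 1 - Pi.single q.1.2.2.2 1 with hw
  have h1 : ∑ a, u a ^ 2 = 2 := hnorm _ _ q.2.1
  have h2 : ∑ a, w a ^ 2 = 2 := hnorm _ _ q.2.2.1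
  have expand : ∑ a, ∑ b, quadCoeff q a b ^ 2 =
      (∑ a, u a ^ 2) * (∑ b, u b ^ 2) + (∑ a, w a ^ 2) * (∑ b, w b ^ 2) -
        2 * ((∑ a, u a * w a) * ∑ b, u b * w b) := by
    simp only [Finset.sum_mul_sum]
    simp only [Finset.mul_sum, ← Finset.sum_add_distrib, ← Finset.sum_sub_distrib]
    refine Finset.sum_congr rfl fun a _ => Finset.sum_congr rfl fun b _ => ?_
    rw [quadCoeff, ← hu, ← hw]
    ring
  rw [expand, h1, h2]
  nlinarith [mul_self_nonneg (∑ a, u a * w a)]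

/-- The Frobenius bound, by the Cauchy-Schwarz inequality for the pairing of a matrix of the class
with the random matrix `∑ t, σ t • quadCoeff (q t)`. -/
lemma sq_expect_iSup_quadDiff_le_frobenius [Finite ι] {μ : ℝ} (G : ι → Matrix (Fin n) (Fin n) ℝ)
    (hG : ∀ i, (G i).PosSemidef) (hμ : ∀ i, maxNorm (G i) ≤ μ) (q : Fin N → Quadruplet n) :
    (𝔼 σ : Fin N → Bool, ⨆ i, ∑ t, signValue (σ t) * quadDiff (q t) (G i)) ^ 2 ≤
      8 * (n * μ) ^ 2 * N := by
  set M : (Fin N → Bool) → Fin n → Fin n → ℝ :=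
    fun σ a b => ∑ t, signValue (σ t) * quadCoeff (q t) a b with hM
  have pairing : ∀ σ i, ∑ t, signValue (σ t) * quadDiff (q t) (G i) =
      ∑ x : Fin n × Fin n, G i x.1 x.2 * M σ x.1 x.2 := fun σ i => by
    simp only [hM, ← sum_quadCoeff_mul (hG i), Finset.mul_sum, Fintype.sum_prod_type]
    rw [Finset.sum_comm]
    refine Finset.sum_congr rfl fun a _ => ?_
    rw [Finset.sum_comm]
    exact Finset.sum_congr rfl fun b _ => Finset.sum_congr rfl fun t _ => by ring
  have hsup : ∀ σ, (⨆ i, ∑ t, signValue (σ t) * quadDiff (q t) (G i)) ^ 2 ≤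
      (n * μ) ^ 2 * ∑ x : Fin n × Fin n, M σ x.1 x.2 ^ 2 := fun σ => by
    obtain ⟨i, hi⟩ := exists_eq_ciSup_of_finite
      (f := fun i => ∑ t, signValue (σ t) * quadDiff (q t) (G i))
    rw [← hi]
    rw [pairing]
    refine (Finset.sum_mul_sq_le_sq_mul_sq _ _ _).trans ?_
    refine mul_le_mul_of_nonneg_right ?_ (Finset.sum_nonneg fun _ _ => sq_nonneg _)
    calc ∑ x : Fin n × Fin n, G i x.1 x.2 ^ 2 ≤ ∑ _x : Fin n × Fin n, μ ^ 2 := by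
          refine Finset.sum_le_sum fun x _ => ?_
          rw [← sq_abs]
          exact pow_le_pow_left₀ (abs_nonneg _)
            ((abs_entry_le_maxNorm (G i) x.1 x.2).trans (hμ i)) 2
      _ = (n * μ) ^ 2 := by simp; ring
  have hsecond : 𝔼 σ, ∑ x : Fin n × Fin n, M σ x.1 x.2 ^ 2 ≤ 8 * N := by
    rw [Finset.expect_sum_comm]
    have : ∀ x : Fin n × Fin n, 𝔼 σ, M σ x.1 x.2 ^ 2 = ∑ t, quadCoeff (q t) x.1 x.2 ^ 2 :=
      fun x => by simpa using expect_sq_signed_sum (fun t => quadCoeff (q t) x.1 x.2) 0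
    simp only [this]
    rw [Finset.sum_comm]
    calc ∑ t, ∑ x : Fin n × Fin n, quadCoeff (q t) x.1 x.2 ^ 2 ≤ ∑ _t : Fin N, (8 : ℝ) := by
          refine Finset.sum_le_sum fun t _ => ?_
          rw [Fintype.sum_prod_type]
          exact sum_sq_quadCoeff_le (q t)
      _ = 8 * N := by simp [mul_comm]
  have jensen := Finset.expect_mul_sq_le_sq_mul_sq Finset.univ
    (fun σ : Fin N → Bool => ⨆ i, ∑ t, signValue (σ t) * quadDiff (q t) (G i)) fun _ => 1
  simp only [mul_one, one_pow, Fintype.expect_const] at jensen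
  calc _ ≤ 𝔼 σ : Fin N → Bool, (n * μ) ^ 2 * ∑ x : Fin n × Fin n, M σ x.1 x.2 ^ 2 :=
        jensen.trans (Finset.expect_le_expect fun σ _ => hsup σ)
    _ ≤ (n * μ) ^ 2 * (8 * N) := by
        rw [← Finset.mul_expect]
        gcongr
    _ = _ := by ring

/-- The bound from the Gram vectors, which form a configuration of `n` points in the ball of radius
`√μ` of `ℝ^p`. -/
lemma sq_expect_iSup_quadDiff_le_net {μ : ℝ} (hμ0 : 0 < μ) (G : ι → Matrix (Fin n) (Fin n) ℝ)
    (hG : ∀ i, (G i).PosSemidef) (hμ : ∀ i, maxNorm (G i) ≤ μ) (hr : ∀ i, (G i).rank ≤ p)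
    (q : Fin N → Quadruplet n) (hN : 0 < N)
    (hnonneg : 0 ≤ 𝔼 σ : Fin N → Bool, ⨆ i, ∑ t, signValue (σ t) * quadDiff (q t) (G i)) :
    (3 / 4 * 𝔼 σ : Fin N → Bool, ⨆ i, ∑ t, signValue (σ t) * quadDiff (q t) (G i)) ^ 2 ≤
      μ ^ 2 * (32 * N * (n * p * Real.log 33)) := by
  choose x hx using fun i => exists_gram_vectors (hG i) (hr i)
  have hle : ∀ σ : Fin N → Bool, ⨆ i, ∑ t, signValue (σ t) * quadDiff (q t) (G i) ≤
      μ * configSup (EuclideanSpace ℝ (Fin p)) q σ := fun σ => ciSup_le fun i => by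
    have hball : ∀ k, ‖(√μ)⁻¹ • x i k‖ ≤ 1 := fun k => by
      rw [norm_smul, norm_inv, Real.norm_of_nonneg (Real.sqrt_nonneg _),
        inv_mul_le_iff₀ (Real.sqrt_pos.2 hμ0), mul_one]
      exact Real.le_sqrt_of_sq_le (norm_sq_gram_vector_le (hx i) (hμ i) k)
    have hscale : ∀ q, quadDiff q (G i) = μ * configDiff q fun k => (√μ)⁻¹ • x i k := fun q => by
      rw [quadDiff_eq_configDiff (hx i), configDiff_smul, inv_pow, Real.sq_sqrt hμ0.le,
        mul_inv_cancel_left₀ hμ0.ne']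
    simp only [hscale, mul_left_comm _ μ, ← Finset.mul_sum]
    exact mul_le_mul_of_nonneg_left (le_configSup q σ hball) hμ0.le
  have hmean := Finset.expect_le_expect (s := Finset.univ) fun σ _ => hle σ
  rw [← Finset.mul_expect] at hmean
  have hnet := sq_expect_configSup_le (E := EuclideanSpace ℝ (Fin p)) q hN
  rw [finrank_euclideanSpace_fin] at hnet
  calc _ ≤ (3 / 4 * (μ * 𝔼 σ, configSup (EuclideanSpace ℝ (Fin p)) q σ)) ^ 2 := by gcongr
    _ = μ ^ 2 * (3 / 4 * 𝔼 σ, configSup (EuclideanSpace ℝ (Fin p)) q σ) ^ 2 := by ring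
    _ ≤ _ := by gcongr

lemma two_le_log_of_log_lt (hn : 2 ≤ n) (h : 16 * Real.log n < n) : 2 ≤ Real.log n := by
  have hlog2 := Real.log_two_gt_d9
  have h2 : Real.log 2 ≤ Real.log n := Real.log_le_log (by norm_num) (by exact_mod_cast hn)
  have h8 : (8 : ℝ) ≤ n := by linarith
  have h3 : Real.log ((2 : ℝ) ^ 3) ≤ Real.log n := Real.log_le_log (by norm_num) (by linarith)
  rw [Real.log_pow] at h3
  push_cast at h3
  linarith

/-- The Rademacher average of the class. The Frobenius bound is strong enough as long as
`n ≤ 16 log n`; for larger `n` the factor `log n` exceeds the constants in the net bound. -/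
theorem expect_iSup_quadDiff_le [Finite ι] {μ : ℝ} (hn : 2 ≤ n) (hp : 1 ≤ p) (hN : 1 ≤ N)
    (hμ0 : 0 < μ)
    (G : ι → Matrix (Fin n) (Fin n) ℝ) (hG : ∀ i, (G i).PosSemidef)
    (hμ : ∀ i, maxNorm (G i) ≤ μ) (hr : ∀ i, (G i).rank ≤ p) (q : Fin N → Quadruplet n) :
    𝔼 σ : Fin N → Bool, ⨆ i, ∑ t, signValue (σ t) * quadDiff (q t) (G i) ≤
      2 * μ * √(32 * n * p * Real.log n * N) := by
  set S := 𝔼 σ : Fin N → Bool, ⨆ i, ∑ t, signValue (σ t) * quadDiff (q t) (G i) with hS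
  have hlog : 0 ≤ Real.log n := Real.log_natCast_nonneg n
  rcases lt_or_ge S 0 with hneg | hnonneg
  · exact hneg.le.trans (by positivity)
  suffices h : S ^ 2 ≤ (2 * μ) ^ 2 * (32 * n * p * Real.log n * N) by
    refine (Real.le_sqrt_of_sq_le h).trans_eq ?_
    rw [Real.sqrt_mul (sq_nonneg _), Real.sqrt_sq (by positivity)]
  have hp' : (1 : ℝ) ≤ p := by exact_mod_cast hp
  rcases le_or_gt (n : ℝ) (16 * Real.log n) with hsmall | hlarge
  · calc S ^ 2 ≤ 8 * (n * μ) ^ 2 * N := sq_expect_iSup_quadDiff_le_frobenius G hG hμ q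
      _ = 8 * μ ^ 2 * n * N * n := by ring
      _ ≤ 8 * μ ^ 2 * n * N * (16 * Real.log n) := by gcongr
      _ = 128 * μ ^ 2 * n * N * Real.log n * 1 := by ring
      _ ≤ 128 * μ ^ 2 * n * N * Real.log n * p := by gcongr
      _ = _ := by ring
  · have h2 := two_le_log_of_log_lt hn hlarge
    have h := sq_expect_iSup_quadDiff_le_net hμ0 G hG hμ hr q hN hnonneg
    have h33 : Real.log 33 ≤ 9 / 4 * Real.log n := by
      have h64 : Real.log 33 ≤ Real.log ((2 : ℝ) ^ 6) := Real.log_le_log (by norm_num) (by norm_num)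
      rw [Real.log_pow] at h64
      push_cast at h64
      linarith [Real.log_two_lt_d9]
    rw [← hS] at h
    calc S ^ 2 = 16 / 9 * (3 / 4 * S) ^ 2 := by ring
      _ ≤ 16 / 9 * (μ ^ 2 * (32 * N * (n * p * (9 / 4 * Real.log n)))) := by
          refine mul_le_mul_of_nonneg_left (h.trans ?_) (by norm_num)
          gcongr
      _ = _ := by ring

end Rademacher

/-! ### The loss and empirical risk minimization -/

section Loss

variable {n p N : ℕ} {μ lam γ₀ ν : ℝ}

lemma abs_twoSidedHinge_sub_le (hν : 0 ≤ ν) (a b : ℝ) :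
    |twoSidedHinge γ₀ ν a - twoSidedHinge γ₀ ν b| ≤ (1 + ν) * |a - b| := by
  have h1 : |max (γ₀ - a) 0 - max (γ₀ - b) 0| ≤ |a - b| := by
    refine (abs_max_sub_max_le_abs _ _ _).trans_eq ?_
    rw [abs_sub_comm]
    congr 1; ring
  have h2 : |max (a - γ₀) 0 - max (b - γ₀) 0| ≤ |a - b| := by
    refine (abs_max_sub_max_le_abs _ _ _).trans_eq ?_
    congr 1; ring
  calc |twoSidedHinge γ₀ ν a - twoSidedHinge γ₀ ν b|
      = |(max (γ₀ - a) 0 - max (γ₀ - b) 0) + ν * (max (a - γ₀) 0 - max (b - γ₀) 0)| := by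
        simp only [twoSidedHinge]; congr 1; ring
    _ ≤ |a - b| + ν * |a - b| := by
        refine (abs_add_le _ _).trans ?_
        rw [abs_mul, abs_of_nonneg hν]
        gcongr
    _ = _ := by ring

lemma abs_hinge_margin_sub_le (hν : 0 ≤ ν) (z : Observation n) (G H : Matrix (Fin n) (Fin n) ℝ) :
    |twoSidedHinge γ₀ ν (margin z G) - twoSidedHinge γ₀ ν (margin z H)| ≤
      (1 + ν) * |quadDiff z.1 G - quadDiff z.1 H| := by
  have hlabel : |labelValue z.2| = 1 := by cases z.2 <;> simp [labelValue]
  refine (abs_twoSidedHinge_sub_le hν _ _).trans_eq ?_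
  rw [margin, margin, ← mul_sub, abs_mul, hlabel, one_mul]

/-- The loss of `G` in excess of the loss of the reference matrix `H`. -/
def excessLoss (γ₀ ν : ℝ) (H G : Matrix (Fin n) (Fin n) ℝ) (z : Observation n) : ℝ :=
  twoSidedHinge γ₀ ν (margin z G) - twoSidedHinge γ₀ ν (margin z H)

lemma abs_excessLoss_le (hν : 0 ≤ ν) {G H : Matrix (Fin n) (Fin n) ℝ}
    (hG : G ∈ gramClass n μ lam) (hH : H ∈ gramClass n μ lam) (z : Observation n) :
    |excessLoss γ₀ ν H G z| ≤ 8 * μ * (1 + ν) := by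
  refine (abs_hinge_margin_sub_le hν z G H).trans ?_
  have h1 := abs_quadDiff_le hG.1 hG.2.1 z.1
  have h2 := abs_quadDiff_le hH.1 hH.2.1 z.1
  have h3 := abs_sub (quadDiff z.1 G) (quadDiff z.1 H)
  calc _ ≤ (1 + ν) * (4 * μ + 4 * μ) := by gcongr; linarith
    _ = _ := by ring

lemma integral_excessLoss (η : Quadruplet n → unitInterval) (H G : Matrix (Fin n) (Fin n) ℝ)
    [IsProbabilityMeasure (observationLaw η)] :
    ∫ z, excessLoss γ₀ ν H G z ∂observationLaw η = risk η γ₀ ν G - risk η γ₀ ν H :=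
  integral_sub Integrable.of_finite Integrable.of_finite

/-- A solution of the program minimizes the empirical loss: the optimal slack variables for `H` are
the two parts of the hinge loss, and no feasible slack variables are smaller. -/
lemma sum_excessLoss_nonpos_of_isSolution (hN : 0 < N) (hν : 0 ≤ ν) {s : Fin N → Observation n}
    {G H : Matrix (Fin n) (Fin n) ℝ} (hG : IsSolution p μ lam γ₀ ν s G)
    (hH : H ∈ gramClass n μ lam) (hr : H.rank ≤ p) :
    ∑ t, excessLoss γ₀ ν H G (s t) ≤ 0 := by
  obtain ⟨ξ, ε, hfeas, hmin⟩ := hG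
  have hopt := hmin H (fun t => max (γ₀ - margin (s t) H) 0) (fun t => max (margin (s t) H - γ₀) 0)
    ⟨fun t => ⟨by linarith [le_max_left (γ₀ - margin (s t) H) 0],
      by linarith [le_max_left (margin (s t) H - γ₀) 0], le_max_right _ _, le_max_right _ _⟩,
      hH, hr⟩
  simp only [objective] at hopt
  rw [mul_le_mul_iff_right₀ (by positivity)] at hopt
  have hslack : ∑ t, twoSidedHinge γ₀ ν (margin (s t) G) ≤ ∑ t, (ξ t + ν * ε t) := by
    refine Finset.sum_le_sum fun t _ => ?_
    obtain ⟨h1, h2, h3, h4⟩ := hfeas.1 t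
    exact add_le_add (max_le (by linarith) h3)
      (mul_le_mul_of_nonneg_left (max_le (by linarith) h4) hν)
  simp only [excessLoss, Finset.sum_sub_distrib]
  have := hslack.trans hopt
  simp only [twoSidedHinge] at this ⊢
  linarith

end Loss

/-! ### The uniform deviation over a finite subfamily of the class -/

section Deviation

variable {n p N : ℕ} {μ lam γ₀ ν δ : ℝ} {ι : Type*} [Finite ι] [Nonempty ι]

lemma mul_sqrt_div_self (hN : 0 < N) (x : ℝ) : N * √(x / N) = √(x * N) := by
  have hN' : (0 : ℝ) < N := by exact_mod_cast hN
  rw [show x * N = (N : ℝ) ^ 2 * (x / N) by field_simp, Real.sqrt_mul (sq_nonneg _),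
    Real.sqrt_sq hN'.le]

/-- The largest difference, over the family `G`, between the excess risk and the empirical excess
risk relative to `H`, multiplied by the sample size. -/
noncomputable def deviation (η : Quadruplet n → unitInterval) (γ₀ ν : ℝ)
    (H : Matrix (Fin n) (Fin n) ℝ) (G : ι → Matrix (Fin n) (Fin n) ℝ)
    (s : Fin N → Observation n) : ℝ :=
  ⨆ i, ∑ t, (∫ z, excessLoss γ₀ ν H (G i) z ∂observationLaw η - excessLoss γ₀ ν H (G i) (s t))

lemma integral_deviation_le (hn : 2 ≤ n) (hp : 1 ≤ p) (hN : 1 ≤ N) (hν : 0 ≤ ν) (hμ : 0 < μ)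
    (η : Quadruplet n → unitInterval) (H : Matrix (Fin n) (Fin n) ℝ)
    (G : ι → Matrix (Fin n) (Fin n) ℝ) (hG : ∀ i, G i ∈ gramClass n μ lam)
    (hr : ∀ i, (G i).rank ≤ p) :
    ∫ s, deviation η γ₀ ν H G s ∂sampleLaw η N ≤
      N * (4 * μ * (1 + ν) * √(32 * n * p * Real.log n / N)) := by
  have := isProbabilityMeasure_observationLaw hn η
  have hL : ∀ i j z, |excessLoss γ₀ ν H (G i) z - excessLoss γ₀ ν H (G j) z| ≤
      |(1 + ν) * quadDiff z.1 (G i) - (1 + ν) * quadDiff z.1 (G j)| := fun i j z => by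
    rw [excessLoss, excessLoss, sub_sub_sub_cancel_right, ← mul_sub, abs_mul,
      abs_of_nonneg (by positivity : 0 ≤ 1 + ν)]
    exact abs_hinge_margin_sub_le hν z (G i) (G j)
  have hsymm := integral_iSup_deviation_le (observationLaw η)
    (fun i => excessLoss γ₀ ν H (G i)) (fun i z => (1 + ν) * quadDiff z.1 (G i)) hL N 0
  simp only [Pi.zero_apply, zero_add] at hsymm
  refine hsymm.trans ?_
  have hrad : ∀ s : Fin N → Observation n, 𝔼 σ : Fin N → Bool,
      ⨆ i, ∑ t, signValue (σ t) * (2 * ((1 + ν) * quadDiff (s t).1 (G i))) ≤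
      N * (4 * μ * (1 + ν) * √(32 * n * p * Real.log n / N)) := fun s => by
    have h := expect_iSup_quadDiff_le hn hp hN hμ G (fun i => (hG i).1) (fun i => (hG i).2.1) hr
      fun t => (s t).1
    calc _ = 2 * (1 + ν) * 𝔼 σ : Fin N → Bool,
          ⨆ i, ∑ t, signValue (σ t) * quadDiff (s t).1 (G i) := by
          rw [Finset.mul_expect]
          refine Finset.expect_congr rfl fun σ _ => ?_
          rw [Real.mul_iSup_of_nonneg (by positivity)]
          simp only [Finset.mul_sum]
          congr 1; ext i
          exact Finset.sum_congr rfl fun t _ => by ring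
      _ ≤ 2 * (1 + ν) * (2 * μ * √(32 * n * p * Real.log n * N)) := by gcongr
      _ = _ := by rw [← mul_sqrt_div_self hN]; ring
  calc _ ≤ ∫ _s, N * (4 * μ * (1 + ν) * √(32 * n * p * Real.log n / N))
        ∂Measure.pi (fun _ : Fin N => observationLaw η) :=
        integral_mono Integrable.of_finite Integrable.of_finite hrad
    _ = _ := by simp

lemma abs_deviation_update_le (hν : 0 ≤ ν)
    (η : Quadruplet n → unitInterval) {H : Matrix (Fin n) (Fin n) ℝ}
    (hH : H ∈ gramClass n μ lam) (G : ι → Matrix (Fin n) (Fin n) ℝ)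
    (hG : ∀ i, G i ∈ gramClass n μ lam) (s : Fin N → Observation n) (t : Fin N)
    (z : Observation n) :
    |deviation η γ₀ ν H G s - deviation η γ₀ ν H G (Function.update s t z)| ≤
      16 * μ * (1 + ν) := by
  have hterm : ∀ i, |∑ t', (∫ z, excessLoss γ₀ ν H (G i) z ∂observationLaw η -
        excessLoss γ₀ ν H (G i) (s t')) -
      ∑ t', (∫ z, excessLoss γ₀ ν H (G i) z ∂observationLaw η -
        excessLoss γ₀ ν H (G i) (Function.update s t z t'))| ≤ 16 * μ * (1 + ν) := fun i => by
    rw [← Finset.sum_sub_distrib, Finset.sum_eq_single t]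
    · rw [Function.update_self, sub_sub_sub_cancel_left]
      have h1 := abs_excessLoss_le (γ₀ := γ₀) hν (hG i) hH z
      have h2 := abs_excessLoss_le (γ₀ := γ₀) hν (hG i) hH (s t)
      have h3 := abs_sub (excessLoss γ₀ ν H (G i) z) (excessLoss γ₀ ν H (G i) (s t))
      linarith
    · intro t' _ ht'
      rw [Function.update_of_ne ht', sub_self]
    · simp
  have hle : ∀ f g : ι → ℝ, (∀ i, |f i - g i| ≤ 16 * μ * (1 + ν)) →
      (⨆ i, f i) - (⨆ i, g i) ≤ 16 * μ * (1 + ν) := fun f g h => by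
    rw [sub_le_iff_le_add]
    refine ciSup_le fun i => ?_
    linarith [le_ciSup (Set.finite_range g).bddAbove i, (abs_le.1 (h i)).2]
  rw [abs_le']
  refine ⟨hle _ _ hterm, ?_⟩
  rw [neg_sub]
  exact hle _ _ fun i => by rw [abs_sub_comm]; exact hterm i

/-- With probability at least `1 - δ / 2`, no member of a finite family has an excess risk that
exceeds its empirical excess risk by `riskBound`. -/
lemma measureReal_deviation_ge_le (hn : 2 ≤ n) (hp : 1 ≤ p) (hN : 1 ≤ N) (hν : 0 ≤ ν)
    (hμ : 0 < μ) (hδ : 0 < δ) (hδ1 : δ < 1) (η : Quadruplet n → unitInterval)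
    {H : Matrix (Fin n) (Fin n) ℝ} (hH : H ∈ gramClass n μ lam)
    (G : ι → Matrix (Fin n) (Fin n) ℝ) (hG : ∀ i, G i ∈ gramClass n μ lam)
    (hr : ∀ i, (G i).rank ≤ p) :
    (sampleLaw η N).real {s | N * riskBound n p N μ ν δ ≤ deviation η γ₀ ν H G s} ≤ δ / 2 := by
  have := isProbabilityMeasure_observationLaw hn η
  have hN' : (0 : ℝ) < N := by exact_mod_cast hN
  have hlog : 0 < Real.log (2 / δ) := Real.log_pos (by rw [lt_div_iff₀ hδ]; linarith)
  let c : ℝ≥0 := ⟨16 * μ * (1 + ν), by positivity⟩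
  have hsub := hasSubgaussianMGF_of_bounded_differences (observationLaw η) (c := c)
    (deviation (N := N) η γ₀ ν H G) fun s t z => abs_deviation_update_le hν η hH G hG s t z
  -- with variance proxy `N * (8 * μ * (1 + ν)) ^ 2` the tail exponent at `r` is `-log (2 / δ)`
  set r : ℝ := N * (8 * μ * (1 + ν) * √(2 * Real.log (2 / δ) / N)) with hrdef
  have htail := hsub.measure_ge_le (ε := r) (by positivity)
  have hexp : -r ^ 2 / (2 * ((N * (c / 2) ^ 2 : ℝ≥0) : ℝ)) = -Real.log (2 / δ) := by
    have hc : ((N * (c / 2) ^ 2 : ℝ≥0) : ℝ) = N * (16 * μ * (1 + ν) / 2) ^ 2 := by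
      push_cast; rfl
    rw [hc, hrdef, mul_pow, mul_pow, Real.sq_sqrt (by positivity)]
    have : 1 + ν ≠ 0 := by positivity
    field_simp
    norm_num
  rw [hexp, Real.exp_neg, Real.exp_log (by positivity), inv_div] at htail
  have hmean := integral_deviation_le (γ₀ := γ₀) hn hp hN hν hμ η H G hG hr
  unfold sampleLaw at hmean ⊢
  refine (measureReal_mono fun s hs => ?_).trans htail
  have hs' : N * riskBound n p N μ ν δ ≤ deviation η γ₀ ν H G s := hs
  rw [riskBound, mul_add, ← hrdef] at hs'
  simp only [Set.mem_ofPred_eq]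
  linarith

end Deviation

/-! ### Excess risk of the solutions -/

section ExcessRisk

variable {n p N : ℕ} {μ lam γ₀ ν δ : ℝ}

lemma nonneg_of_mem_gramClass {G : Matrix (Fin n) (Fin n) ℝ} (h : G ∈ gramClass n μ lam)
    (hn : 0 < n) : 0 ≤ μ :=
  ((abs_nonneg _).trans (abs_entry_le_maxNorm G ⟨0, hn⟩ ⟨0, hn⟩)).trans h.2.1

lemma riskBound_nonneg (hμ : 0 ≤ μ) (hν : 0 ≤ ν) : 0 ≤ riskBound n p N μ ν δ := by
  unfold riskBound
  positivity

lemma rank_transpose_mul_self_le (X : Matrix (Fin p) (Fin n) ℝ) : (X.transpose * X).rank ≤ p := by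
  rw [Matrix.rank_transpose_mul_self]
  exact X.rank_le_height

/-- In the degenerate cases `p = 0` and `μ = 0` all distances vanish. -/
lemma quadDiff_eq_zero {G : Matrix (Fin n) (Fin n) ℝ} (hG : G ∈ gramClass n μ lam)
    (hr : G.rank ≤ p) (h : p = 0 ∨ μ = 0) (q : Quadruplet n) : quadDiff q G = 0 := by
  rcases h with rfl | rfl
  · obtain ⟨x, hx⟩ := exists_gram_vectors hG.1 hr
    rw [quadDiff_eq_configDiff hx, Subsingleton.elim x 0]
    simp [configDiff]
  · simpa using abs_quadDiff_le hG.1 hG.2.1 q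

/-- The excess risk bound holds for all solutions at once. The sample space is finite, so a family
with one violating matrix for each bad sample is finite, and the deviation inequality applies to
it. -/
theorem ofReal_le_sampleLaw_excess_risk_le (hn : 2 ≤ n) (hN : 1 ≤ N) (hν : 0 ≤ ν) (hδ : 0 < δ)
    (hδ1 : δ < 1) (η : Quadruplet n → unitInterval) {H : Matrix (Fin n) (Fin n) ℝ}
    (hH : H ∈ gramClass n μ lam) (hr : H.rank ≤ p) :
    ENNReal.ofReal (1 - δ) ≤ sampleLaw η N
      {s | ∀ G : Matrix (Fin n) (Fin n) ℝ, IsSolution p μ lam γ₀ ν s G →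
        risk η γ₀ ν G - risk η γ₀ ν H ≤ riskBound n p N μ ν δ} := by
  have := isProbabilityMeasure_observationLaw hn η
  have : IsProbabilityMeasure (sampleLaw η N) := by unfold sampleLaw; infer_instance
  have hμ := nonneg_of_mem_gramClass hH (by omega)
  set good : Set (Fin N → Observation n) :=
    {s | ∀ G : Matrix (Fin n) (Fin n) ℝ, IsSolution p μ lam γ₀ ν s G →
      risk η γ₀ ν G - risk η γ₀ ν H ≤ riskBound n p N μ ν δ} with hgood
  suffices hbad : (sampleLaw η N).real goodᶜ ≤ δ by
    refine ENNReal.ofReal_le_of_le_toReal ?_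
    change 1 - δ ≤ (sampleLaw η N).real good
    rw [probReal_compl_eq_one_sub (MeasurableSet.of_discrete)] at hbad
    linarith
  by_cases hdeg : p = 0 ∨ μ = 0
  · have huniv : goodᶜ = ∅ := by
      refine Set.compl_empty_iff.2 (Set.eq_univ_of_forall fun s G hsol => ?_)
      obtain ⟨ξ, ε, hfeas, -⟩ := hsol
      have : risk η γ₀ ν G = risk η γ₀ ν H := by
        simp only [risk, margin, quadDiff_eq_zero hfeas.2.1 hfeas.2.2 hdeg,
          quadDiff_eq_zero hH hr hdeg]
      rw [this, sub_self]
      exact riskBound_nonneg hμ hν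
    rw [huniv]
    simpa using hδ.le
  · rw [not_or] at hdeg
    have hviol : ∀ s, ∃ G ∈ gramClass n μ lam, G.rank ≤ p ∧ (s ∉ good →
        IsSolution p μ lam γ₀ ν s G ∧
          riskBound n p N μ ν δ < risk η γ₀ ν G - risk η γ₀ ν H) := fun s => by
      by_cases hs : s ∈ good
      · exact ⟨H, hH, hr, fun h => absurd hs h⟩
      · simp only [hgood, Set.mem_ofPred_eq, not_forall, not_le] at hs
        obtain ⟨G, hsol, hlt⟩ := hs
        obtain ⟨ξ, ε, hfeas, hmin⟩ := hsol
        exact ⟨G, hfeas.2.1, hfeas.2.2, fun _ => ⟨⟨ξ, ε, hfeas, hmin⟩, hlt⟩⟩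
    choose G hG hGr hGs using hviol
    have hob : Nonempty (Fin N → Observation n) := (sampleLaw η N).nonempty_of_neZero
    have hdev := measureReal_deviation_ge_le (γ₀ := γ₀) hn (Nat.one_le_iff_ne_zero.2 hdeg.1) hN hν
      (lt_of_le_of_ne hμ (Ne.symm hdeg.2)) hδ hδ1 η hH G hG hGr
    refine (measureReal_mono fun s hs => ?_).trans (hdev.trans (by linarith))
    obtain ⟨hsol, hlt⟩ := hGs s hs
    have herm := sum_excessLoss_nonpos_of_isSolution (by omega) hν hsol hH hr
    calc N * riskBound n p N μ ν δ ≤ N * (risk η γ₀ ν (G s) - risk η γ₀ ν H) := by gcongr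
      _ ≤ ∑ t, (∫ z, excessLoss γ₀ ν H (G s) z ∂observationLaw η -
            excessLoss γ₀ ν H (G s) (s t)) := by
          rw [integral_excessLoss, Finset.sum_sub_distrib]
          simp only [Finset.sum_const, Finset.card_univ, Fintype.card_fin, nsmul_eq_mul]
          linarith
      _ ≤ _ := le_ciSup (f := fun s' => ∑ t, (∫ z, excessLoss γ₀ ν H (G s') z ∂observationLaw η -
            excessLoss γ₀ ν H (G s') (s t))) (Set.finite_range _).bddAbove s

lemma one_le_mul_log (hn : 2 ≤ n) (hp : 1 ≤ p) : 1 ≤ p * n * Real.log n := by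
  have hn' : (2 : ℝ) ≤ n := by exact_mod_cast hn
  have hp' : (1 : ℝ) ≤ p := by exact_mod_cast hp
  have hlog : Real.log 2 ≤ Real.log n := Real.log_le_log (by norm_num) hn'
  have := Real.log_two_gt_d9
  calc (1 : ℝ) ≤ 1 * 2 * Real.log 2 := by linarith
    _ ≤ _ := by gcongr

lemma mul_sqrt_le_of_sq_le {a b τ : ℝ} (ha : 0 ≤ a) (hτ : 0 ≤ τ) (h : a ^ 2 * b ≤ τ ^ 2) :
    a * √b ≤ τ := by
  rw [← Real.sqrt_sq ha, ← Real.sqrt_mul (sq_nonneg a)]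
  exact Real.sqrt_le_iff.2 ⟨hτ, h⟩

/-- A sample size beyond which each of the two terms of `riskBound` is at most `τ / 2`. -/
lemma riskBound_le {K τ : ℝ} (hn : 2 ≤ n) (hp : 1 ≤ p) (hμ : 0 ≤ μ) (hν : 0 ≤ ν) (hδ : 0 < δ)
    (hδ1 : δ < 1) (hτ : 0 < τ) (hK0 : 0 < K)
    (hK1 : (4 * μ * (1 + ν)) ^ 2 * 32 * 4 / τ ^ 2 ≤ K)
    (hK2 : (8 * μ * (1 + ν)) ^ 2 * (2 * Real.log (2 / δ)) * 4 / τ ^ 2 ≤ K)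
    (hN : K * (p * n * Real.log n) ≤ N) : riskBound n p N μ ν δ ≤ τ := by
  have hm := one_le_mul_log hn hp
  have hN0 : (0 : ℝ) < N := lt_of_lt_of_le (by positivity) hN
  have hlog : 0 < Real.log (2 / δ) := Real.log_pos (by rw [lt_div_iff₀ hδ]; linarith)
  rw [div_le_iff₀ (by positivity)] at hK1 hK2
  have h1 : 4 * μ * (1 + ν) * √(32 * n * p * Real.log n / N) ≤ τ / 2 := by
    refine mul_sqrt_le_of_sq_le (by positivity) (by positivity) ?_
    rw [← mul_div_assoc, div_le_iff₀ hN0]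
    calc (4 * μ * (1 + ν)) ^ 2 * (32 * n * p * Real.log n)
        = (4 * μ * (1 + ν)) ^ 2 * 32 * 4 * (p * n * Real.log n) / 4 := by ring
      _ ≤ K * τ ^ 2 * (p * n * Real.log n) / 4 := by gcongr
      _ = (τ / 2) ^ 2 * (K * (p * n * Real.log n)) := by ring
      _ ≤ _ := by gcongr
  have h2 : 8 * μ * (1 + ν) * √(2 * Real.log (2 / δ) / N) ≤ τ / 2 := by
    refine mul_sqrt_le_of_sq_le (by positivity) (by positivity) ?_
    rw [← mul_div_assoc, div_le_iff₀ hN0]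
    calc (8 * μ * (1 + ν)) ^ 2 * (2 * Real.log (2 / δ))
        = (8 * μ * (1 + ν)) ^ 2 * (2 * Real.log (2 / δ)) * 4 * 1 / 4 := by ring
      _ ≤ K * τ ^ 2 * (p * n * Real.log n) / 4 := by gcongr
      _ = (τ / 2) ^ 2 * (K * (p * n * Real.log n)) := by ring
      _ ≤ _ := by gcongr
  unfold riskBound
  linarith

end ExcessRisk

end OrdinalEmbedding

theorem theorem1 :
    -- the excess risk bound, for all solutions simultaneously, with probability at least `1 - δ`
    (∀ (n p N : ℕ) (_ : 2 ≤ n) (_ : 1 ≤ N) (μ lam γ₀ ν δ : ℝ) (_ : 0 ≤ ν) (_ : 0 < δ) (_ : δ < 1)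
        (η : Quadruplet n → unitInterval)
        (X : Matrix (Fin p) (Fin n) ℝ) (_ : X.transpose * X ∈ gramClass n μ lam),
      ENNReal.ofReal (1 - δ) ≤ sampleLaw η N
        {s | ∀ G : Matrix (Fin n) (Fin n) ℝ, IsSolution p μ lam γ₀ ν s G →
          risk η γ₀ ν G - risk η γ₀ ν (X.transpose * X) ≤ riskBound n p N μ ν δ}) ∧
    -- a sample size of exact order `p n log n` suffices for any prescribed accuracy
    (∀ (μ ν δ τ : ℝ) (_ : 0 ≤ ν) (_ : 0 < δ) (_ : δ < 1) (_ : 0 < τ),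
      ∃ (c C : ℝ) (N₀ : ℕ → ℕ → ℕ), 0 < c ∧
        (∀ n p : ℕ, 2 ≤ n → 1 ≤ p →
          c * (p * n * Real.log n) ≤ N₀ n p ∧ N₀ n p ≤ C * (p * n * Real.log n)) ∧
        ∀ (n p N : ℕ) (_ : 2 ≤ n) (_ : 1 ≤ p) (_ : N₀ n p ≤ N) (lam γ₀ : ℝ)
            (η : Quadruplet n → unitInterval)
            (X : Matrix (Fin p) (Fin n) ℝ) (_ : X.transpose * X ∈ gramClass n μ lam),
          ENNReal.ofReal (1 - δ) ≤ sampleLaw η N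
            {s | ∀ G : Matrix (Fin n) (Fin n) ℝ, IsSolution p μ lam γ₀ ν s G →
              risk η γ₀ ν G - risk η γ₀ ν (X.transpose * X) ≤ τ}) := by
  refine ⟨fun n p N hn hN μ lam γ₀ ν δ hν hδ hδ1 η X hX =>
    ofReal_le_sampleLaw_excess_risk_le hn hN hν hδ hδ1 η hX (rank_transpose_mul_self_le X),
    fun μ ν δ τ hν hδ hδ1 hτ => ?_⟩
  have hlog : 0 < Real.log (2 / δ) := Real.log_pos (by rw [lt_div_iff₀ hδ]; linarith)
  have hA : 0 ≤ (4 * μ * (1 + ν)) ^ 2 * 32 * 4 / τ ^ 2 := by positivity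
  have hB : 0 ≤ (8 * μ * (1 + ν)) ^ 2 * (2 * Real.log (2 / δ)) * 4 / τ ^ 2 := by positivity
  -- the last two summands are what `riskBound_le` asks for; the first makes the sample nonempty
  set K : ℝ := 1 + (4 * μ * (1 + ν)) ^ 2 * 32 * 4 / τ ^ 2 +
    (8 * μ * (1 + ν)) ^ 2 * (2 * Real.log (2 / δ)) * 4 / τ ^ 2 with hK
  have hK1 : 1 ≤ K := by linarith
  refine ⟨K, K + 1, fun n p => ⌈K * (p * n * Real.log n)⌉₊, by linarith,
    fun n p hn hp => ⟨Nat.le_ceil _, ?_⟩, fun n p N hn hp hN lam γ₀ η X hX => ?_⟩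
  · have hm := one_le_mul_log hn hp
    have := Nat.ceil_lt_add_one (a := K * (p * n * Real.log n)) (by positivity)
    linarith
  · have hm := one_le_mul_log hn hp
    have hN' : K * (p * n * Real.log n) ≤ N := Nat.ceil_le.1 hN
    have hN1 : 1 ≤ N := by
      have : (1 : ℝ) ≤ N := by nlinarith
      exact_mod_cast this
    have hbound : riskBound n p N μ ν δ ≤ τ :=
      riskBound_le hn hp (nonneg_of_mem_gramClass hX (by omega)) hν hδ hδ1 hτ (by linarith)
        (by linarith) (by linarith) hN'
    refine (ofReal_le_sampleLaw_excess_risk_le (γ₀ := γ₀) hn hN1 hν hδ hδ1 η hX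
      (rank_transpose_mul_self_le X)).trans (measure_mono fun s hs G hsol => ?_)
    exact (hs G hsol).trans hbound
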